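/- A residuated lattice is an algebra $\mathbf A=\langle A,\wedge,\vee,\cdot,\backslash,/,1\rangle$ such that $\langle A,\wedge,\vee\rangle$ is a lattice, $\langle A,\cdot,1\rangle$ is a monoid and, for all $x,y,z\in A$, $xy\le z\iff y\le x\backslash z\iff x\le z/y$, where $\le$ is the lattice order. It is distributive if its lattice reduct is a distributive lattice, and integral if $1$ is its greatest element. A partial subalgebra of $\mathbf A$ is a nonempty subset $B\subseteq A$ together with, for each operation symbol $f$, a partial operation $f^{\mathbf B}$ on $B$ of the same arity, such that $f^{\mathbf B}(b_1,\dots,b_n)=f^{\mathbf A}(b_1,\dots,b_n)$ whenever the left-hand side is defined. An embedding of $\mathbf B$ into an algebra $\mathbf C$ of the same language is an injective map $\varphi\colon B\to C$ such that $\varphi(f^{\mathbf B}(b_1,\dots,b_n))=f^{\mathbf C}(\varphi(b_1),\dots,\varphi(b_n))$ whenever $f^{\mathbf B}(b_1,\dots,b_n)$ is defined. Corollary 5.14. The class of distributive integral residuated lattices is a variety (that is, it is the class of all algebras of its language satisfying some set of equations), and it has the finite embeddability property: every finite partial subalgebra of a distributive integral residuated lattice can be embedded into a finite distributive integral residuated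 lattice. -/

import Mathlib

universe u v w

/-! Algebras over an algebraic language (operation symbols of finite arity, no relation symbols) are
Mathlib's `L.Structure A` with `[L.IsAlgebraic]`. A class of algebras is a predicate on them. -/

/-- A class of algebras of the language `L`, as a predicate. (Only nonempty algebras matter in
the notions below.) -/
abbrev AlgebraClass (L : FirstOrder.Language.{v, w}) : Type (max v w (u + 1)) :=
  (A : Type u) → L.Structure A → Prop

/-- A partial algebra on `P`: each `n`-ary operation symbol is interpreted as a partial
`n`-ary operation on `P`. -/
structure PartialAlgebra (L : FirstOrder.Language.{v, w}) (P : Type u) where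
  /-- the partial operation interpreting an operation symbol -/
  op : {n : ℕ} → L.Functions n → (Fin n → P) →. P

namespace PartialAlgebra

variable {L : FirstOrder.Language.{v, w}}

/-- An algebra, regarded as a partial algebra all of whose operations are total. -/
def ofTotal {A : Type u} (S : L.Structure A) : PartialAlgebra L A where
  op f := fun a => Part.some (S.funMap f a)

/-- Homomorphisms of partial algebras: whenever `f (p₁, …, pₙ)` exists in the source and equals `r`,
then `f (φ p₁, …, φ pₙ)` exists in the target and equals `φ r`. -/
def IsHom {P Q : Type u} (PP : PartialAlgebra L P) (QQ : PartialAlgebra L Q) (φ : P → Q) : Prop :=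
  ∀ (n : ℕ) (f : L.Functions n) (p : Fin n → P) (r : P),
    r ∈ PP.op f p → φ r ∈ QQ.op f (fun i => φ (p i))

/-- Embeddings of partial algebras: injective homomorphisms. -/
def IsEmbedding {P Q : Type u} (PP : PartialAlgebra L P) (QQ : PartialAlgebra L Q)
    (φ : P → Q) : Prop :=
  Function.Injective φ ∧ IsHom PP QQ φ

/-- A partial algebra on a subset `B` of `Q` is a partial subalgebra of `QQ` if the inclusion map
is a homomorphism. It need not be full: an operation may be undefined in it although
its value in `QQ` lies in `B`. -/
def IsPartialSubalgebra {Q : Type u} {B : Set Q} (BB : PartialAlgebra L B)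
    (QQ : PartialAlgebra L Q) : Prop :=
  IsHom BB QQ (Subtype.val : B → Q)

end PartialAlgebra

/-- The algebra `(A, S)` has the finite embeddability property in the class `K`: every finite
(nonempty) partial subalgebra of it embeds into a finite algebra of `K`. -/
def HasFEPIn {L : FirstOrder.Language.{v, w}} [L.IsAlgebraic] (K : AlgebraClass.{u} L)
    (A : Type u) (S : L.Structure A) : Prop :=
  ∀ (B : Set A) (BB : PartialAlgebra L B), B.Nonempty → B.Finite →
    BB.IsPartialSubalgebra (PartialAlgebra.ofTotal S) →
    ∃ (C : Type u) (T : L.Structure C), Finite C ∧ K C T ∧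
      ∃ φ : B → C, BB.IsEmbedding (PartialAlgebra.ofTotal T) φ

/-- The class `K` has the finite embeddability property: each of its members has it in `K`. -/
def HasFEP {L : FirstOrder.Language.{v, w}} [L.IsAlgebraic] (K : AlgebraClass.{u} L) : Prop :=
  ∀ (A : Type u) (S : L.Structure A), K A S → HasFEPIn K A S

/-- The class `K` is a variety (equational class): for some set of equations between terms, its
members are exactly the (nonempty) algebras satisfying these equations under all assignments. -/
def IsVariety {L : FirstOrder.Language.{v, w}} [L.IsAlgebraic] (K : AlgebraClass.{u} L) : Prop :=
  ∃ E : Set (L.Term ℕ × L.Term ℕ), ∀ (A : Type u) (S : L.Structure A), Nonempty A →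
    (K A S ↔ ∀ e ∈ E, ∀ a : ℕ → A, e.1.realize a = e.2.realize a)

/-- Residuated lattices: a lattice and a monoid on the same set, with two residuals of the
multiplication. (The residuation laws force the multiplication to be order-preserving in
both coordinates, so this need not be required separately.) -/
class ResiduatedLattice (A : Type u) extends Lattice A, Monoid A where
  /-- the left residual `x \ z` -/
  ldiv : A → A → A
  /-- the right residual `z / y` -/
  rdiv : A → A → A
  mul_le_iff_le_ldiv : ∀ x y z : A, x * y ≤ z ↔ y ≤ ldiv x z
  mul_le_iff_le_rdiv : ∀ x y z : A, x * y ≤ z ↔ x ≤ rdiv z y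

/-- The operation symbols of residuated lattices: five binary ones and a constant. -/
inductive RLFunctions : ℕ → Type
  | meet : RLFunctions 2
  | join : RLFunctions 2
  | mul : RLFunctions 2
  | ldiv : RLFunctions 2
  | rdiv : RLFunctions 2
  | one : RLFunctions 0

/-- The algebraic language of residuated lattices. -/
abbrev RLLanguage : FirstOrder.Language.{0, 0} where
  Functions := RLFunctions
  Relations := fun _ => Empty

instance RLLanguage.isAlgebraic : RLLanguage.IsAlgebraic :=
  fun _ => inferInstanceAs (IsEmpty Empty)

/-- A residuated lattice as an algebra `(A, ⊓, ⊔, ·, \, /, 1)`. -/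
abbrev ResiduatedLattice.toAlgebra {A : Type u} (R : ResiduatedLattice A) :
    RLLanguage.Structure A where
  funMap := fun {_} f => match f with
    | RLFunctions.meet => fun a => a 0 ⊓ a 1
    | RLFunctions.join => fun a => a 0 ⊔ a 1
    | RLFunctions.mul => fun a => a 0 * a 1
    | RLFunctions.ldiv => fun a => R.ldiv (a 0) (a 1)
    | RLFunctions.rdiv => fun a => R.rdiv (a 0) (a 1)
    | RLFunctions.one => fun _ => 1
  RelMap := fun {_} r => Empty.elim r

/-- The class of distributive integral residuated lattices: the algebras that come from a
residuated lattice whose lattice reduct is distributive and whose unit is the top element. -/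
def DIRL : AlgebraClass.{u} RLLanguage := fun A S =>
  ∃ R : ResiduatedLattice A, R.toAlgebra = S ∧
    (∀ x y z : A, x ⊓ (y ⊔ z) = (x ⊓ y) ⊔ (x ⊓ z)) ∧
    (∀ x : A, x ≤ 1)

/-!
The class is axiomatized by the lattice and monoid equations, distributivity, `x ⊓ 1 = x`, and
equations equivalent to the residuation laws (`ResiduatedLattice.ofEquations`,
`DIRL.isVariety`).

For the finite embeddability property, let `B` be a finite subset of a distributive integral
residuated lattice `A`, and put `S = B ∪ {1}`. Let `W` be the subset of `A` generated by `S` under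
multiplication and meet. Consider the sets `{w ∈ W | f w ≤ b}` where `b ∈ S` and `f : A → A` is a
join-preserving function generated pointwise from the identity and the constants in `S` by
multiplication and meet. This family is closed under inverse images along the translations of `W`
by multiplication and by meet. Hence the intersections of such sets form a complete lattice in
which both the product and the meet have residuals: the former makes it an integral residuated
lattice, the latter makes it distributive (`IsTranslationClosed.dirl`).
Sending `b ∈ B` to `{w ∈ W | w ≤ b}` preserves all operations that are defined in `B`; for joins
this holds because the functions `f` preserve joins (`DIRL.hasFEP`).

Finiteness comes from well-quasi-ordering. By integrality the multiplication and the meet are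
decreasing, so by Higman's theorem (`OpTerm.wellQuasiOrdered_eval`), applied to the algebra of
functions `A → A`, the generated functions are well-quasi-ordered by `≥`; so is `W`, whose elements
correspond to the generated constant functions. A monotone family of up-closed subsets of a
well-quasi-order, indexed by a well-quasi-order, is finite
(`Set.finite_range_of_wellQuasiOrdered`), so there are finitely many sets `{w ∈ W | f w ≤ b}`, and
finitely many intersections of them.
-/

/-! ### Well-quasi-ordering of generated elements -/

/-- Formal terms over generators `β`, with one binary operation symbol for each element of `ι`. -/
inductive OpTerm (ι : Type v) (β : Type w) : Type (max v w)
  | gen : β → OpTerm ι β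
  | node : ι → OpTerm ι β → OpTerm ι β → OpTerm ι β

namespace OpTerm

variable {ι : Type v} {β : Type w} {M : Type u}

/-- The number of leaves of a term. -/
def size : OpTerm ι β → ℕ
  | gen _ => 1
  | node _ s t => s.size + t.size

theorem size_pos : ∀ t : OpTerm ι β, 0 < t.size
  | gen _ => Nat.one_pos
  | node _ s _ => Nat.add_pos_left s.size_pos _

/-- The value of a term, given the binary operations and the values of the generators. -/
def eval (op : ι → M → M → M) (g : β → M) : OpTerm ι β → M
  | gen b => g b
  | node i s t => op i (s.eval op g) (t.eval op g)

/-- A form of Higman's theorem on ordering by divisibility: if finitely many binary operations are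
monotone and decreasing, then the elements generated by finitely many elements are
well-quasi-ordered by `≥`. The proof is the minimal bad sequence argument of Nash-Williams: in a
bad sequence that is minimal with respect to size, the immediate subterms are
well-quasi-ordered, and hence so are the terms themselves. -/
theorem wellQuasiOrdered_eval [Preorder M] [Finite ι] [Finite β] (op : ι → M → M → M) (g : β → M)
    (mono : ∀ i a b c d, a ≤ b → c ≤ d → op i a c ≤ op i b d)
    (le_left : ∀ i a b, op i a b ≤ a) (le_right : ∀ i a b, op i a b ≤ b) :
    WellQuasiOrdered fun s t : OpTerm ι β => t.eval op g ≤ s.eval op g := by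
  set r : OpTerm ι β → OpTerm ι β → Prop := fun s t => t.eval op g ≤ s.eval op g with hr
  have : IsPreorder (OpTerm ι β) r :=
    { refl := fun _ => le_refl _, trans := fun _ _ _ h₁ h₂ => le_trans h₂ h₁ }
  rw [← Set.partiallyWellOrderedOn_univ_iff,
    Set.PartiallyWellOrderedOn.iff_not_exists_isMinBadSeq size]
  rintro ⟨f, hf, hmin⟩
  have hbad : ∀ m n, m < n → ¬ r (f m) (f n) := hf.2
  -- Only finitely many terms of the sequence are generators.
  obtain ⟨k, hk⟩ := Set.PartiallyWellOrderedOn.exists_notMem_of_gt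
    ((Set.finite_range (gen : β → OpTerm ι β)).partiallyWellOrderedOn (r := r)) hbad
  have hnode : ∀ n, ∃ i s t, f (k + 1 + n) = node i s t := fun n => by
    cases h : f (k + 1 + n) with
    | gen b => exact absurd ⟨b, h.symm⟩ (hk (k + 1 + n) (by omega))
    | node i s t => exact ⟨i, s, t, rfl⟩
  choose i s t hst using hnode
  have hsub : {x | ∃ n, x = s n ∨ x = t n}.PartiallyWellOrderedOn r := by
    rw [Set.partiallyWellOrderedOn_iff_exists_lt]
    intro h hh
    by_contra! hgood
    have hpar : ∀ m, ∃ n, (h m).size < (f n).size ∧ r (h m) (f n) := fun m => by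
      obtain ⟨n, hn⟩ := hh m
      refine ⟨k + 1 + n, ?_⟩
      rw [hst n]
      rcases hn with hn | hn <;> rw [hn]
      · exact ⟨Nat.lt_add_of_pos_right (t n).size_pos, le_left _ _ _⟩
      · exact ⟨Nat.lt_add_of_pos_left (s n).size_pos, le_right _ _ _⟩
    choose a hsize ha using hpar
    -- Continue `f` by the subterms from the one whose parent occurs first.
    obtain ⟨m₀, hm₀⟩ : ∃ m₀, ∀ m, a m₀ ≤ a m := 
      ⟨Function.argmin a, fun m => Function.argmin_le a m⟩
    refine hmin (a m₀) (fun n => if n < a m₀ then f n else h (m₀ + (n - a m₀)))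
      (fun m hm => (if_pos hm).symm) (by simpa using hsize m₀) ⟨fun _ => Set.mem_univ _, ?_⟩
    intro m n hmn
    rcases lt_or_ge n (a m₀) with hn | hn
    · simpa only [if_pos hn, if_pos (hmn.trans hn)] using hbad m n hmn
    rcases lt_or_ge m (a m₀) with hm | hm
    · simp only [if_pos hm, if_neg hn.not_gt]
      exact fun hle => hbad m _ (hm.trans_le (hm₀ _)) (_root_.trans hle (ha _))
    · simp only [if_neg hm.not_gt, if_neg hn.not_gt]
      exact hgood _ _ (by omega)
  obtain ⟨p, hp⟩ := hsub.exists_monotone_subseq (f := s) fun n => ⟨n, Or.inl rfl⟩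
  obtain ⟨q, hq⟩ := hsub.exists_monotone_subseq (f := fun n => t (p n)) fun n => ⟨p n, Or.inr rfl⟩
  obtain ⟨m, n, hmn, hi⟩ := Finite.wellQuasiOrdered (α := ι) (· = ·) fun n => i (p (q n))
  refine hbad (k + 1 + p (q m)) (k + 1 + p (q n)) ?_ ?_
  · exact Nat.add_lt_add_left (p.strictMono (q.strictMono hmn)) _
  · rw [hst, hst, hi]
    exact mono _ _ _ _ _ (hp _ _ (q.monotone hmn.le)) (hq _ _ hmn.le)

end OpTerm

/-- A monotone family of up-closed subsets of a well-quasi-order, indexed by a well-quasi-order,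
has only finitely many members: otherwise it contains a strictly increasing sequence, and points
witnessing the strict inclusions form a bad sequence. -/
theorem Set.finite_range_of_wellQuasiOrdered {I : Type v} {α : Type w} {r : I → I → Prop}
    {s : α → α → Prop} [IsPreorder I r] (hr : WellQuasiOrdered r) (hs : WellQuasiOrdered s)
    (D : I → Set α) (mono : ∀ i j, r i j → D i ⊆ D j)
    (up : ∀ i x y, s x y → x ∈ D i → y ∈ D i) : (Set.range D).Finite := by
  by_contra hinf
  let e := Set.Infinite.natEmbedding (Set.range D) hinf
  choose f hf using fun n => (e n).2
  obtain ⟨g, hg⟩ := hr.exists_monotone_subseq f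
  have hmono : Monotone fun n => D (f (g n)) := fun m n hmn => mono _ _ (hg m n hmn)
  have hinj : Function.Injective fun n => D (f (g n)) := fun m n h => by
    simp only [hf] at h
    exact g.injective (e.injective (Subtype.ext h))
  have hstrict := hmono.strictMono_of_injective hinj
  choose x hx hx' using fun n => Set.exists_of_ssubset (hstrict (Nat.lt_succ_self n))
  obtain ⟨m, n, hmn, h⟩ := hs x
  exact hx' n (up _ _ _ h (hmono (Nat.succ_le_of_lt hmn) (hx m)))

/-! ### The residuated lattice of closed sets -/

/-- A family of subsets of a monoid with meets that is closed under arbitrary intersections and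
under inverse images along the translations `w * ·`, `· * w` and `w ⊓ ·`, and consists of lower
sets. It is the family of closed sets of a nucleus on the power set, for the
multiplication and the meet operation simultaneously. -/
structure IsTranslationClosed {W : Type u} [Monoid W] [SemilatticeInf W]
    (K : Set (Set W)) : Prop where
  sInter_mem : ∀ T ⊆ K, ⋂₀ T ∈ K
  isLowerSet : ∀ X ∈ K, IsLowerSet X
  mul_left_mem : ∀ (w : W), ∀ X ∈ K, {x | w * x ∈ X} ∈ K
  mul_right_mem : ∀ (w : W), ∀ X ∈ K, {x | x * w ∈ X} ∈ K
  inf_mem : ∀ (w : W), ∀ X ∈ K, {x | w ⊓ x ∈ X} ∈ K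

namespace IsTranslationClosed

theorem eq_of_subset_iff {W : Type u} {K : Set (Set W)} {X Y : K}
    (h : ∀ Z : K, X.1 ⊆ Z.1 ↔ Y.1 ⊆ Z.1) : X = Y :=
  Subtype.ext (((h Y).2 subset_rfl).antisymm ((h X).1 subset_rfl))

variable {W : Type u} [Monoid W] [SemilatticeInf W] {K : Set (Set W)}

/-- The least member of the family containing a given set. -/
def hull (hK : IsTranslationClosed K) (X : Set W) : K :=
  ⟨⋂₀ {Z | Z ∈ K ∧ X ⊆ Z}, hK.sInter_mem _ fun _ h => h.1⟩

theorem hull_subset_iff (hK : IsTranslationClosed K) {X : Set W} {Z : K} :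
    (hK.hull X).1 ⊆ Z.1 ↔ X ⊆ Z.1 :=
  ⟨fun h => (Set.subset_sInter fun _ h => h.2).trans h, fun h => Set.sInter_subset_of_mem ⟨Z.2, h⟩⟩

theorem iInter_mem (hK : IsTranslationClosed K) {X : Set W} {Y : W → Set W}
    (hY : ∀ x, Y x ∈ K) : {w | ∀ x ∈ X, w ∈ Y x} ∈ K := by
  have : {w | ∀ x ∈ X, w ∈ Y x} = ⋂₀ (Y '' X) := by ext; simp
  rw [this]
  exact hK.sInter_mem _ (by rintro _ ⟨x, -, rfl⟩; exact hY x)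

/-- The product of two members of the family: the hull of the elementwise product. -/
def mul (hK : IsTranslationClosed K) (X Y : K) : K :=
  hK.hull {w | ∃ x ∈ X.1, ∃ y ∈ Y.1, x * y = w}

/-- The left residual `X \ Z`. -/
def ldiv (hK : IsTranslationClosed K) (X Z : K) : K :=
  ⟨{w | ∀ x ∈ X.1, x * w ∈ Z.1}, hK.iInter_mem fun x => hK.mul_left_mem x _ Z.2⟩

/-- The right residual `Z / Y`. -/
def rdiv (hK : IsTranslationClosed K) (Z Y : K) : K :=
  ⟨{w | ∀ y ∈ Y.1, w * y ∈ Z.1}, hK.iInter_mem fun y => hK.mul_right_mem y _ Z.2⟩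

/-- The relative pseudocomplement `X ⇨ Z`. -/
def himp (hK : IsTranslationClosed K) (X Z : K) : K :=
  ⟨{w | ∀ x ∈ X.1, x ⊓ w ∈ Z.1}, hK.iInter_mem fun x => hK.inf_mem x _ Z.2⟩

theorem mul_subset_iff (hK : IsTranslationClosed K) {X Y Z : K} :
    (hK.mul X Y).1 ⊆ Z.1 ↔ ∀ x ∈ X.1, ∀ y ∈ Y.1, x * y ∈ Z.1 := by
  rw [mul, hull_subset_iff]
  exact ⟨fun h x hx y hy => h ⟨x, hx, y, hy, rfl⟩,
    by rintro h _ ⟨x, hx, y, hy, rfl⟩; exact h x hx y hy⟩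

theorem mul_subset_iff_subset_ldiv (hK : IsTranslationClosed K) {X Y Z : K} :
    (hK.mul X Y).1 ⊆ Z.1 ↔ Y.1 ⊆ (hK.ldiv X Z).1 :=
  hK.mul_subset_iff.trans ⟨fun h y hy x hx => h x hx y hy, fun h x hx _ hy => h hy x hx⟩

theorem mul_subset_iff_subset_rdiv (hK : IsTranslationClosed K) {X Y Z : K} :
    (hK.mul X Y).1 ⊆ Z.1 ↔ X.1 ⊆ (hK.rdiv Z Y).1 :=
  hK.mul_subset_iff

theorem inter_subset_iff_subset_himp (hK : IsTranslationClosed K) {X Y Z : K} :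
    X.1 ∩ Y.1 ⊆ Z.1 ↔ Y.1 ⊆ (hK.himp X Z).1 :=
  ⟨fun h _ hy _ hx => h ⟨hK.isLowerSet _ X.2 inf_le_left hx, hK.isLowerSet _ Y.2 inf_le_right hy⟩,
    fun h w hw => inf_idem w ▸ h hw.2 w hw.1⟩

theorem univ_mem (hK : IsTranslationClosed K) : Set.univ ∈ K :=
  Set.sInter_empty ▸ hK.sInter_mem ∅ (Set.empty_subset K)

theorem inter_mem (hK : IsTranslationClosed K) (X Y : K) : X.1 ∩ Y.1 ∈ K :=
  Set.sInter_pair X.1 Y.1 ▸ hK.sInter_mem _ (Set.pair_subset X.2 Y.2)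

/-- If the unit of `W` is its greatest element and the multiplication is decreasing, then the
members of the family form an (integral) residuated lattice, whose meet is the intersection. -/
abbrev residuatedLattice (hK : IsTranslationClosed K) (mul_le_left : ∀ x y : W, x * y ≤ x)
    (mul_le_right : ∀ x y : W, x * y ≤ y) : ResiduatedLattice K where
  le X Y := X.1 ⊆ Y.1
  le_refl _ := subset_rfl
  le_trans _ _ _ := Set.Subset.trans
  le_antisymm _ _ h h' := Subtype.ext (h.antisymm h')
  inf X Y := ⟨X.1 ∩ Y.1, hK.inter_mem X Y⟩
  inf_le_left _ _ := Set.inter_subset_left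
  inf_le_right _ _ := Set.inter_subset_right
  le_inf _ _ _ := Set.subset_inter
  sup X Y := hK.hull (X.1 ∪ Y.1)
  le_sup_left _ _ := Set.subset_union_left.trans (hK.hull_subset_iff.1 subset_rfl)
  le_sup_right _ _ := Set.subset_union_right.trans (hK.hull_subset_iff.1 subset_rfl)
  sup_le _ _ _ h h' := hK.hull_subset_iff.2 (Set.union_subset h h')
  mul := hK.mul
  one := ⟨Set.univ, hK.univ_mem⟩
  mul_assoc X Y Z := eq_of_subset_iff fun T => by
    change (hK.mul (hK.mul X Y) Z).1 ⊆ T.1 ↔ (hK.mul X (hK.mul Y Z)).1 ⊆ T.1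
    rw [mul_subset_iff_subset_rdiv, mul_subset_iff, mul_subset_iff_subset_ldiv, mul_subset_iff]
    exact ⟨fun h y hy z hz x hx => mul_assoc x y z ▸ h x hx y hy z hz,
      fun h x hx y hy z hz => (mul_assoc x y z).symm ▸ h y hy z hz x hx⟩
  one_mul X := eq_of_subset_iff fun T => by
    refine hK.mul_subset_iff.trans ⟨fun h x hx => ?_, fun h w _ x hx => ?_⟩
    · simpa using h 1 (Set.mem_univ _) x hx
    · exact hK.isLowerSet _ T.2 (mul_le_right w x) (h hx)
  mul_one X := eq_of_subset_iff fun T => by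
    refine hK.mul_subset_iff.trans ⟨fun h x hx => ?_, fun h x hx w _ => ?_⟩
    · simpa using h x hx 1 (Set.mem_univ _)
    · exact hK.isLowerSet _ T.2 (mul_le_left x w) (h hx)
  ldiv := hK.ldiv
  rdiv := hK.rdiv
  mul_le_iff_le_ldiv _ _ _ := hK.mul_subset_iff_subset_ldiv
  mul_le_iff_le_rdiv _ _ _ := hK.mul_subset_iff_subset_rdiv

theorem dirl (hK : IsTranslationClosed K) (mul_le_left : ∀ x y : W, x * y ≤ x)
    (mul_le_right : ∀ x y : W, x * y ≤ y) :
    DIRL K (hK.residuatedLattice mul_le_left mul_le_right).toAlgebra := by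
  refine ⟨_, rfl, ?_, fun X => Set.subset_univ X.1⟩
  intro X Y Z
  refine eq_of_subset_iff fun T => ?_
  change X.1 ∩ (hK.hull (Y.1 ∪ Z.1)).1 ⊆ T.1 ↔ (hK.hull (X.1 ∩ Y.1 ∪ X.1 ∩ Z.1)).1 ⊆ T.1
  rw [hK.inter_subset_iff_subset_himp, hull_subset_iff, hull_subset_iff, Set.union_subset_iff,
    Set.union_subset_iff, ← hK.inter_subset_iff_subset_himp, ← hK.inter_subset_iff_subset_himp]

end IsTranslationClosed

/-! ### Equational axioms -/

namespace ResiduatedLattice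

/-- A residuated lattice from its operations, given that the latter satisfy a system of equations.
The residuation laws are expressed by `x((x \ z) ⊓ y) ⊔ z = z`,
`y ⊓ (x \ (xy ⊔ z)) = y` and their mirror images. -/
abbrev ofEquations {A : Type u} [Max A] [Min A] [Monoid A] (ldiv rdiv : A → A → A)
    (sup_comm : ∀ x y : A, x ⊔ y = y ⊔ x) (sup_assoc : ∀ x y z : A, x ⊔ y ⊔ z = x ⊔ (y ⊔ z))
    (inf_comm : ∀ x y : A, x ⊓ y = y ⊓ x) (inf_assoc : ∀ x y z : A, x ⊓ y ⊓ z = x ⊓ (y ⊓ z))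
    (sup_inf_self : ∀ x y : A, x ⊔ x ⊓ y = x) (inf_sup_self : ∀ x y : A, x ⊓ (x ⊔ y) = x)
    (mul_ldiv : ∀ x y z : A, x * (ldiv x z ⊓ y) ⊔ z = z)
    (le_ldiv : ∀ x y z : A, y ⊓ ldiv x (x * y ⊔ z) = y)
    (rdiv_mul : ∀ x y z : A, (rdiv z y ⊓ x) * y ⊔ z = z)
    (le_rdiv : ∀ x y z : A, x ⊓ rdiv (x * y ⊔ z) y = x) : ResiduatedLattice A :=
  letI := Lattice.mk' sup_comm sup_assoc inf_comm inf_assoc sup_inf_self inf_sup_self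
  { ldiv := ldiv
    rdiv := rdiv
    mul_le_iff_le_ldiv := fun x y z => by
      constructor
      · intro h
        have := le_ldiv x y z
        rwa [sup_eq_right.2 h, inf_eq_left] at this
      · intro h
        have := mul_ldiv x y z
        rwa [inf_eq_right.2 h, sup_eq_right] at this
    mul_le_iff_le_rdiv := fun x y z => by
      constructor
      · intro h
        have := le_rdiv x y z
        rwa [sup_eq_right.2 h, inf_eq_left] at this
      · intro h
        have := rdiv_mul x y z
        rwa [inf_eq_right.2 h, sup_eq_right] at this }

end ResiduatedLattice

namespace DIRL

open FirstOrder.Language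

/-- Application of a binary operation symbol to two terms. -/
abbrev app (f : RLFunctions 2) (s t : RLLanguage.Term ℕ) : RLLanguage.Term ℕ :=
  Functions.apply₂ (L := RLLanguage) f s t

/-- The constant term `1`. -/
abbrev oneTerm : RLLanguage.Term ℕ :=
  Constants.term (L := RLLanguage) RLFunctions.one

/-- Equations that define the class of distributive integral residuated lattices. -/
def equations : Set (RLLanguage.Term ℕ × RLLanguage.Term ℕ) :=
  let x : RLLanguage.Term ℕ := Term.var 0
  let y : RLLanguage.Term ℕ := Term.var 1
  let z : RLLanguage.Term ℕ := Term.var 2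
  let m := app .meet
  let j := app .join
  let p := app .mul
  let l := app .ldiv
  let r := app .rdiv
  { (j x y, j y x), (j (j x y) z, j x (j y z)), (m x y, m y x), (m (m x y) z, m x (m y z)),
    (j x (m x y), x), (m x (j x y), x),
    (p (p x y) z, p x (p y z)), (p oneTerm x, x), (p x oneTerm, x),
    (j (p x (m (l x z) y)) z, z), (m y (l x (j (p x y) z)), y),
    (j (p (m (r z y) x) y) z, z), (m x (r (j (p x y) z) y), x),
    (m x (j y z), j (m x y) (m x z)), (m x oneTerm, x) }

theorem isVariety : IsVariety DIRL.{u} := by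
  refine ⟨equations, fun A S _ => ?_⟩
  simp only [equations, Set.forall_mem_insert, Set.mem_singleton_iff, forall_eq,
    Term.realize_functions_apply₂, Term.realize_var, Term.realize_constants]
  constructor
  · rintro ⟨R, rfl, hdist, hone⟩
    have hl : ∀ x y z : A, x * (R.ldiv x z ⊓ y) ≤ z := fun x y z =>
      (R.mul_le_iff_le_ldiv _ _ _).2 inf_le_left
    have hl' : ∀ x y z : A, y ≤ R.ldiv x (x * y ⊔ z) := fun x y z =>
      (R.mul_le_iff_le_ldiv _ _ _).1 le_sup_left
    have hr : ∀ x y z : A, (R.rdiv z y ⊓ x) * y ≤ z := fun x y z =>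
      (R.mul_le_iff_le_rdiv _ _ _).2 inf_le_left
    have hr' : ∀ x y z : A, x ≤ R.rdiv (x * y ⊔ z) y := fun x y z =>
      (R.mul_le_iff_le_rdiv _ _ _).1 le_sup_left
    exact ⟨fun a => sup_comm _ _, fun a => sup_assoc _ _ _, fun a => inf_comm _ _,
      fun a => inf_assoc _ _ _, fun a => sup_inf_self, fun a => inf_sup_self,
      fun a => mul_assoc _ _ _, fun a => one_mul _, fun a => mul_one _,
      fun a => sup_eq_right.2 (hl _ _ _), fun a => inf_eq_left.2 (hl' _ _ _),
      fun a => sup_eq_right.2 (hr _ _ _), fun a => inf_eq_left.2 (hr' _ _ _),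
      fun a => hdist _ _ _, fun a => inf_eq_left.2 (hone _)⟩
  · rintro ⟨h₁, h₂, h₃, h₄, h₅, h₆, h₇, h₈, h₉, h₁₀, h₁₁, h₁₂, h₁₃, h₁₄, h₁₅⟩
    let v : A → A → A → ℕ → A := fun x y z n => match n with
      | 0 => x
      | 1 => y
      | _ => z
    let _ : Max A := ⟨fun x y => S.funMap RLFunctions.join ![x, y]⟩
    let _ : Min A := ⟨fun x y => S.funMap RLFunctions.meet ![x, y]⟩
    let _ : Monoid A :=
      { mul := fun x y => S.funMap RLFunctions.mul ![x, y]
        one := S.funMap RLFunctions.one default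
        mul_assoc := fun x y z => h₇ (v x y z)
        one_mul := fun x => h₈ (v x x x)
        mul_one := fun x => h₉ (v x x x) }
    let R := ResiduatedLattice.ofEquations (fun x z => S.funMap RLFunctions.ldiv ![x, z])
      (fun z y => S.funMap RLFunctions.rdiv ![z, y]) (fun x y => h₁ (v x y y))
      (fun x y z => h₂ (v x y z)) (fun x y => h₃ (v x y y)) (fun x y z => h₄ (v x y z))
      (fun x y => h₅ (v x y y)) (fun x y => h₆ (v x y y)) (fun x y z => h₁₀ (v x y z))
      (fun x y z => h₁₁ (v x y z)) (fun x y z => h₁₂ (v x y z)) (fun x y z => h₁₃ (v x y z))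
    refine ⟨R, ?_, fun x y z => h₁₄ (v x y z), fun x => inf_eq_left.1 (h₁₅ (v x x x))⟩
    have eta : ∀ a : Fin 2 → A, ![a 0, a 1] = a := fun a => by
      funext i; fin_cases i <;> rfl
    refine FirstOrder.Language.Structure.ext ?_ ?_
    · funext n f a
      cases f
      case one => exact congrArg (S.funMap RLFunctions.one) (Subsingleton.elim _ _)
      all_goals exact congrArg (S.funMap _) (eta a)
    · funext n r
      exact r.elim

end DIRL

/-! ### Polynomial functions of a residuated lattice -/

namespace ResiduatedLattice

variable {A : Type u} [R : ResiduatedLattice A]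

theorem mul_sup_le (x y z : A) : x * (y ⊔ z) ≤ x * y ⊔ x * z := by
  rw [R.mul_le_iff_le_ldiv]
  exact sup_le ((R.mul_le_iff_le_ldiv _ _ _).1 le_sup_left)
    ((R.mul_le_iff_le_ldiv _ _ _).1 le_sup_right)

theorem sup_mul_le (x y z : A) : (x ⊔ y) * z ≤ x * z ⊔ y * z := by
  rw [R.mul_le_iff_le_rdiv]
  exact sup_le ((R.mul_le_iff_le_rdiv _ _ _).1 le_sup_left)
    ((R.mul_le_iff_le_rdiv _ _ _).1 le_sup_right)

theorem mul_le_mul_of_le {a b c d : A} (h : a ≤ b) (h' : c ≤ d) : a * c ≤ b * d := by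
  rw [R.mul_le_iff_le_rdiv]
  refine h.trans ((R.mul_le_iff_le_rdiv _ _ _).1 ?_)
  rw [R.mul_le_iff_le_ldiv]
  exact h'.trans ((R.mul_le_iff_le_ldiv _ _ _).1 le_rfl)

theorem mul_le_left (hone : ∀ x : A, x ≤ 1) (x y : A) : x * y ≤ x :=
  (mul_le_mul_of_le le_rfl (hone y)).trans_eq (mul_one x)

theorem mul_le_right (hone : ∀ x : A, x ≤ 1) (x y : A) : x * y ≤ y :=
  (mul_le_mul_of_le (hone x) le_rfl).trans_eq (one_mul y)

/-- The operations `·` (for `true`) and `⊓` (for `false`) on functions `A → A`. -/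
def polyOp : Bool → (A → A) → (A → A) → A → A
  | true, f, g => fun x => f x * g x
  | false, f, g => fun x => f x ⊓ g x

/-- The generators of the polynomial functions: the identity and the constants from `S`. -/
def polyGen (S : Set A) : Option S → A → A
  | none => id
  | some s => fun _ => s

/-- The functions `A → A` generated by the identity and the constants from `S` under pointwise
multiplication and meet. -/
def polys (S : Set A) : Set (A → A) :=
  Set.range (OpTerm.eval (polyOp (A := A)) (polyGen S))

theorem id_mem_polys (S : Set A) : id ∈ polys S := ⟨.gen none, rfl⟩

theorem const_mem_polys {S : Set A} {s : A} (hs : s ∈ S) : (fun _ => s) ∈ polys S :=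
  ⟨.gen (some ⟨s, hs⟩), rfl⟩

theorem mul_mem_polys {S : Set A} {f g : A → A} (hf : f ∈ polys S) (hg : g ∈ polys S) :
    (fun x => f x * g x) ∈ polys S := by
  obtain ⟨s, rfl⟩ := hf
  obtain ⟨t, rfl⟩ := hg
  exact ⟨.node true s t, rfl⟩

theorem inf_mem_polys {S : Set A} {f g : A → A} (hf : f ∈ polys S) (hg : g ∈ polys S) :
    (fun x => f x ⊓ g x) ∈ polys S := by
  obtain ⟨s, rfl⟩ := hf
  obtain ⟨t, rfl⟩ := hg
  exact ⟨.node false s t, rfl⟩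

theorem comp_mem_polys {S : Set A} {f g : A → A} (hf : f ∈ polys S) (hg : g ∈ polys S) :
    (fun x => f (g x)) ∈ polys S := by
  obtain ⟨t, rfl⟩ := hf
  induction t with
  | gen b => cases b with
    | none => exact hg
    | some s => exact const_mem_polys s.2
  | node i s t hs ht => cases i with
    | true => exact mul_mem_polys hs ht
    | false => exact inf_mem_polys hs ht

theorem wellQuasiOrdered_polys (hone : ∀ x : A, x ≤ 1) {S : Set A} (hS : S.Finite) :
    WellQuasiOrdered fun f g : polys S => g.1 ≤ f.1 := by
  have := hS.to_subtype
  have h := OpTerm.wellQuasiOrdered_eval (polyOp (A := A)) (polyGen S)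
    (by
      rintro (_ | _) a b c d h h' x
      exacts [inf_le_inf (h x) (h' x), mul_le_mul_of_le (h x) (h' x)])
    (by
      rintro (_ | _) a b x
      exacts [inf_le_left, mul_le_left hone _ _])
    (by
      rintro (_ | _) a b x
      exacts [inf_le_right, mul_le_right hone _ _])
  intro f
  choose t ht using fun n => (f n).2
  obtain ⟨m, n, hmn, hle⟩ := h t
  exact ⟨m, n, hmn, by simpa only [ht] using hle⟩

/-- The submonoid generated by `S` under multiplication and meet, described as the set of
elements whose constant function is polynomial. -/
def polySubmonoid (S : Set A) (h1 : 1 ∈ S) : Submonoid A where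
  carrier := {a | (fun _ => a) ∈ polys S}
  mul_mem' := mul_mem_polys
  one_mem' := const_mem_polys h1

instance (S : Set A) (h1 : 1 ∈ S) : SemilatticeInf (polySubmonoid S h1) :=
  Subtype.semilatticeInf fun {_ _} => inf_mem_polys

/-- The polynomial functions that are monotone and preserve binary joins. -/
def joinPolys (S : Set A) : Set (A → A) :=
  {f | f ∈ polys S ∧ Monotone f ∧ ∀ x y, f (x ⊔ y) ≤ f x ⊔ f y}

theorem id_mem_joinPolys (S : Set A) : id ∈ joinPolys S :=
  ⟨id_mem_polys S, monotone_id, fun _ _ => le_rfl⟩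

theorem comp_mem_joinPolys {S : Set A} {f g : A → A} (hf : f ∈ joinPolys S)
    (hg : g ∈ joinPolys S) : (fun x => f (g x)) ∈ joinPolys S :=
  ⟨comp_mem_polys hf.1 hg.1, hf.2.1.comp hg.2.1,
    fun x y => (hf.2.1 (hg.2.2 x y)).trans (hf.2.2 _ _)⟩

theorem mul_left_mem_joinPolys {S : Set A} {w : A} (hw : (fun _ => w) ∈ polys S) :
    (fun x => w * x) ∈ joinPolys S :=
  ⟨mul_mem_polys hw (id_mem_polys S), fun _ _ h => mul_le_mul_of_le le_rfl h, mul_sup_le w⟩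

theorem mul_right_mem_joinPolys {S : Set A} {w : A} (hw : (fun _ => w) ∈ polys S) :
    (fun x => x * w) ∈ joinPolys S :=
  ⟨mul_mem_polys (id_mem_polys S) hw, fun _ _ h => mul_le_mul_of_le h le_rfl,
    fun x y => sup_mul_le x y w⟩

theorem inf_mem_joinPolys (hdist : ∀ x y z : A, x ⊓ (y ⊔ z) = (x ⊓ y) ⊔ (x ⊓ z)) {S : Set A}
    {w : A} (hw : (fun _ => w) ∈ polys S) : (fun x => w ⊓ x) ∈ joinPolys S :=
  ⟨inf_mem_polys hw (id_mem_polys S), fun _ _ h => inf_le_inf le_rfl h, fun x y => (hdist w x y).le⟩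

/-! ### The finite algebra of closed sets -/

/-- The set `{w | f w ≤ b}` of elements of the generated submonoid. -/
def basicSet (S : Set A) (h1 : 1 ∈ S) (f : A → A) (b : A) : Set (polySubmonoid S h1) :=
  {w | f w ≤ b}

/-- The sets `{w | f w ≤ b}`, for a join-preserving polynomial function `f` and `b ∈ S`. -/
def basicSets (S : Set A) (h1 : 1 ∈ S) : Set (Set (polySubmonoid S h1)) :=
  {X | ∃ f ∈ joinPolys S, ∃ b ∈ S, X = basicSet S h1 f b}

/-- The intersections of basic sets. -/
def closedSets (S : Set A) (h1 : 1 ∈ S) : Set (Set (polySubmonoid S h1)) :=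
  {X | ∃ T ⊆ basicSets S h1, X = ⋂₀ T}

theorem basicSet_mem_closedSets {S : Set A} (h1 : 1 ∈ S) {f : A → A} (hf : f ∈ joinPolys S) {b : A}
    (hb : b ∈ S) : basicSet S h1 f b ∈ closedSets S h1 :=
  ⟨{basicSet S h1 f b}, Set.singleton_subset_iff.2 ⟨f, hf, b, hb, rfl⟩,
    (Set.sInter_singleton _).symm⟩

/-- There are finitely many basic sets, because the polynomial functions and the generated
submonoid are well-quasi-ordered by `≥`, and `{w | f w ≤ b}` is antitone in `f` and a lower
set. -/
theorem finite_basicSets (hone : ∀ x : A, x ≤ 1) {S : Set A} (hS : S.Finite) (h1 : 1 ∈ S) :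
    (basicSets S h1).Finite := by
  have hwqo := wellQuasiOrdered_polys hone hS
  have : IsPreorder (joinPolys S) fun f g => g.1 ≤ f.1 :=
    { refl := fun _ => le_rfl, trans := fun _ _ _ h h' => h'.trans h }
  have hJ : WellQuasiOrdered fun f g : joinPolys S => g.1 ≤ f.1 := fun f =>
    hwqo fun n => ⟨f n, (f n).2.1⟩
  have hW : WellQuasiOrdered fun v w : polySubmonoid S h1 => w ≤ v := fun w => by
    obtain ⟨m, n, hmn, h⟩ := hwqo fun n => ⟨fun _ => (w n : A), (w n).2⟩
    -- Constant functions are compared at an arbitrary point.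
    exact ⟨m, n, hmn, h 1⟩
  refine (hS.biUnion fun b _ => Set.finite_range_of_wellQuasiOrdered hJ hW
    (fun f => basicSet S h1 f.1 b) (fun f g h w hw => (h w).trans hw)
    fun f v w h hv => (f.2.2.1 h).trans hv).subset ?_
  rintro _ ⟨f, hf, b, hb, rfl⟩
  exact Set.mem_biUnion hb ⟨⟨f, hf⟩, rfl⟩

theorem finite_closedSets (hone : ∀ x : A, x ≤ 1) {S : Set A} (hS : S.Finite) (h1 : 1 ∈ S) :
    (closedSets S h1).Finite := by
  refine ((finite_basicSets hone hS h1).finite_subsets.image Set.sInter).subset ?_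
  rintro _ ⟨T, hT, rfl⟩
  exact ⟨T, hT, rfl⟩

theorem preimage_mem_closedSets {S : Set A} {h1 : 1 ∈ S} {g : A → A} (hg : g ∈ joinPolys S)
    (g' : polySubmonoid S h1 → polySubmonoid S h1) (hg' : ∀ w, (g' w : A) = g w)
    {X : Set (polySubmonoid S h1)} (hX : X ∈ closedSets S h1) :
    {x | g' x ∈ X} ∈ closedSets S h1 := by
  obtain ⟨T, hT, rfl⟩ := hX
  refine ⟨(fun Y => {x | g' x ∈ Y}) '' T, ?_, by ext; simp⟩
  rintro _ ⟨Y, hY, rfl⟩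
  obtain ⟨f, hf, b, hb, rfl⟩ := hT hY
  exact ⟨_, comp_mem_joinPolys hf hg, b, hb, by ext x; simp [basicSet, hg']⟩

theorem isTranslationClosed_closedSets (hdist : ∀ x y z : A, x ⊓ (y ⊔ z) = (x ⊓ y) ⊔ (x ⊓ z))
    (S : Set A) (h1 : 1 ∈ S) : IsTranslationClosed (closedSets S h1) where
  sInter_mem T hT := by
    refine ⟨{Y | Y ∈ basicSets S h1 ∧ ⋂₀ T ⊆ Y}, fun _ h => h.1, ?_⟩
    refine (Set.subset_sInter fun _ h => h.2).antisymm (Set.subset_sInter fun X hX => ?_)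
    obtain ⟨U, hU, rfl⟩ := hT hX
    exact Set.subset_sInter fun Y hY => Set.sInter_subset_of_mem
      ⟨hU hY, (Set.sInter_subset_of_mem hX).trans (Set.sInter_subset_of_mem hY)⟩
  isLowerSet := by
    rintro _ ⟨T, hT, rfl⟩
    refine isLowerSet_sInter fun Y hY => ?_
    obtain ⟨f, hf, b, -, rfl⟩ := hT hY
    exact fun v w h hv => (hf.2.1 h).trans hv
  mul_left_mem w _ := preimage_mem_closedSets (mul_left_mem_joinPolys w.2) _ fun _ => rfl
  mul_right_mem w _ := preimage_mem_closedSets (mul_right_mem_joinPolys w.2) _ fun _ => rfl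
  inf_mem w _ := preimage_mem_closedSets (inf_mem_joinPolys hdist w.2) _ fun _ => rfl

/-- The closed set of all elements below a given element of `S`. -/
def principal (S : Set A) (h1 : 1 ∈ S) (b : S) : closedSets S h1 :=
  ⟨basicSet S h1 id b, basicSet_mem_closedSets h1 (id_mem_joinPolys S) b.2⟩

/-- An element of `S`, as an element of the generated submonoid. -/
def ofMem (S : Set A) (h1 : 1 ∈ S) (b : S) : polySubmonoid S h1 := ⟨b, const_mem_polys b.2⟩

theorem ofMem_mem_principal (S : Set A) (h1 : 1 ∈ S) (b : S) :
    ofMem S h1 b ∈ (principal S h1 b).1 := le_refl (b : A)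

theorem principal_injective (S : Set A) (h1 : 1 ∈ S) : Function.Injective (principal S h1) :=
  fun b c h => Subtype.ext (le_antisymm
    (show ofMem S h1 b ∈ (principal S h1 c).1 from h ▸ ofMem_mem_principal S h1 b)
    (show ofMem S h1 c ∈ (principal S h1 b).1 from h ▸ ofMem_mem_principal S h1 c))

theorem principal_subset_iff {S : Set A} {h1 : 1 ∈ S}
    (hK : IsTranslationClosed (closedSets S h1)) (b : S) (X : closedSets S h1) : (principal S h1 b).1 ⊆ X.1 ↔ ofMem S h1 b ∈ X.1 :=
  ⟨fun h => h (ofMem_mem_principal S h1 b), fun h _ hw => hK.isLowerSet _ X.2 hw h⟩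

/-- Closed sets contain the join of any two of their elements, as far as it lies in `S`, since the
functions defining basic sets preserve joins. -/
theorem sup_mem_closedSet {S : Set A} {h1 : 1 ∈ S} (X : closedSets S h1) {b c d : S}
    (hd : (b ⊔ c : A) = d) (hb : ofMem S h1 b ∈ X.1) (hc : ofMem S h1 c ∈ X.1) :
    ofMem S h1 d ∈ X.1 := by
  obtain ⟨X, T, hT, rfl⟩ := X
  intro Y hY
  obtain ⟨f, hf, e, -, rfl⟩ := hT hY
  have : f (b ⊔ c) ≤ e := (hf.2.2 b c).trans (sup_le (hb _ hY) (hc _ hY))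
  rwa [hd] at this

end ResiduatedLattice

namespace DIRL

open ResiduatedLattice

theorem hasFEP : HasFEP DIRL.{u} := by
  rintro A _ ⟨R, rfl, hdist, hone⟩ B BB - hB hsub
  set S : Set A := insert 1 B
  have h1 : (1 : A) ∈ S := Set.mem_insert _ _
  have hS : S.Finite := hB.insert 1
  have hK := isTranslationClosed_closedSets hdist S h1
  have hl : ∀ x y : polySubmonoid S h1, x * y ≤ x := fun x y => mul_le_left hone (x : A) y
  have hr : ∀ x y : polySubmonoid S h1, x * y ≤ y := fun x y => mul_le_right hone (x : A) y
  have hsubset : ∀ {b : S} {X : closedSets S h1},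
      (principal S h1 b).1 ⊆ X.1 ↔ ofMem S h1 b ∈ X.1 :=
    principal_subset_iff hK _ _
  let i : B → S := Set.inclusion (Set.subset_insert 1 B)
  refine ⟨closedSets S h1, (hK.residuatedLattice hl hr).toAlgebra,
    (finite_closedSets hone hS h1).to_subtype, hK.dirl hl hr, fun b => principal S h1 (i b),
    (principal_injective S h1).comp (Set.inclusion_injective _), ?_⟩
  intro n f p r hrp
  have hval := Part.mem_some_iff.1 (hsub n f p r hrp)
  refine Part.mem_some_iff.2 ?_
  cases f with
  | meet =>
    change (r : A) = (p 0 : A) ⊓ (p 1 : A) at hval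
    change principal S h1 (i r) = ⟨(principal S h1 (i (p 0))).1 ∩ (principal S h1 (i (p 1))).1, _⟩
    refine Subtype.ext (Set.ext fun w => ?_)
    change (w : A) ≤ r ↔ (w : A) ≤ p 0 ∧ (w : A) ≤ p 1
    rw [hval, le_inf_iff]
  | join =>
    change (r : A) = (p 0 : A) ⊔ (p 1 : A) at hval
    change principal S h1 (i r) =
      hK.hull ((principal S h1 (i (p 0))).1 ∪ (principal S h1 (i (p 1))).1)
    refine IsTranslationClosed.eq_of_subset_iff fun X => ?_
    rw [hK.hull_subset_iff, Set.union_subset_iff, hsubset, hsubset, hsubset]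
    refine ⟨fun h => ⟨?_, ?_⟩, fun h => sup_mem_closedSet X hval.symm h.1 h.2⟩
    · exact hK.isLowerSet _ X.2 (show (p 0 : A) ≤ r from hval ▸ le_sup_left) h
    · exact hK.isLowerSet _ X.2 (show (p 1 : A) ≤ r from hval ▸ le_sup_right) h
  | mul =>
    change (r : A) = p 0 * p 1 at hval
    change principal S h1 (i r) = hK.mul (principal S h1 (i (p 0))) (principal S h1 (i (p 1)))
    refine IsTranslationClosed.eq_of_subset_iff fun X => ?_
    rw [hK.mul_subset_iff, hsubset]
    have hprod : ofMem S h1 (i r) = ofMem S h1 (i (p 0)) * ofMem S h1 (i (p 1)) := Subtype.ext hval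
    refine ⟨fun h x hx y hy => hK.isLowerSet _ X.2 ?_ h, fun h => hprod ▸
      h _ (ofMem_mem_principal S h1 _) _ (ofMem_mem_principal S h1 _)⟩
    rw [hprod]
    exact mul_le_mul_of_le (A := A) hx hy
  | ldiv =>
    change (r : A) = R.ldiv (p 0) (p 1) at hval
    change principal S h1 (i r) = hK.ldiv (principal S h1 (i (p 0))) (principal S h1 (i (p 1)))
    refine Subtype.ext (Set.ext fun w => ?_)
    change (w : A) ≤ r ↔ ∀ x : polySubmonoid S h1, (x : A) ≤ p 0 → (x * w : A) ≤ p 1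
    rw [hval, ← R.mul_le_iff_le_ldiv]
    exact ⟨fun h x hx => (mul_le_mul_of_le hx le_rfl).trans h,
      fun h => h (ofMem S h1 (i (p 0))) le_rfl⟩
  | rdiv =>
    change (r : A) = R.rdiv (p 0) (p 1) at hval
    change principal S h1 (i r) = hK.rdiv (principal S h1 (i (p 0))) (principal S h1 (i (p 1)))
    refine Subtype.ext (Set.ext fun w => ?_)
    change (w : A) ≤ r ↔ ∀ y : polySubmonoid S h1, (y : A) ≤ p 1 → (w * y : A) ≤ p 0
    rw [hval, ← R.mul_le_iff_le_rdiv]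
    exact ⟨fun h y hy => (mul_le_mul_of_le le_rfl hy).trans h,
      fun h => h (ofMem S h1 (i (p 1))) le_rfl⟩
  | one =>
    change (r : A) = 1 at hval
    change principal S h1 (i r) = ⟨Set.univ, _⟩
    refine Subtype.ext (Set.eq_univ_of_forall fun w => ?_)
    change (w : A) ≤ r
    exact hval ▸ hone w

end DIRL

/-- The class of distributive integral residuated lattices is a variety and has the finite
embeddability property. -/
theorem corollary5p14 :
    IsVariety DIRL.{u} ∧ HasFEP DIRL.{u} := by
  exact ⟨DIRL.isVariety, DIRL.hasFEP⟩
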